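/- Let $\Delta$ be a $d$-dimensional simplicial complex on the vertex set $[n]=\{1,\dots,n\}$ (the empty set is its single $(-1)$-dimensional face), with faces oriented by the natural order of $[n]$. Let $\Delta_i$ be its set of $i$-faces, $C_i(\Delta)=\mathbb{Z}\Delta_i$ the integral $i$-chains, $\partial_i\colon C_i(\Delta)\to C_{i-1}(\Delta)$ the (augmented) simplicial boundary maps, $\widetilde H_i(\Delta)=\ker\partial_i/\operatorname{im}\partial_{i+1}$ reduced homology and $\tilde\beta_i=\operatorname{rk}_{\mathbb Z}\widetilde H_i$. Let $L_i=\partial_{i+1}\partial_{i+1}^t$ be the $i$-th Laplacian and $K_i(\Delta)=\ker\partial_i/\operatorname{im}L_i$ the $i$-th critical group. A chain $\sigma\in C_i(\Delta)$ is *winnable* if there is $v\in C_i(\Delta)$ such that all coefficients of $\sigma+L_iv$ are nonnegative. Let $\Lambda_i(\Delta)\subseteq C_i(\Delta)$ be the set of nonnegative integer combinations of the chains $\partial_{i+1}(f)$, $f\in\Delta_{i+1}$, and let $X_i(\Delta)=\{\sigma\in C_i(\Delta):\partial_i(\sigma)\in\Lambda_{i-1}(\Delta)\}$ be the Corry–Keenan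 set. Let $\mathrm{Skel}_i(\Delta)$ be the subcomplex of faces of dimension at most $i$. A *spanning $i$-forest* of $\Delta$ is an $i$-dimensional subcomplex $\Upsilon\subseteq\Delta$ with $\mathrm{Skel}_{i-1}(\Upsilon)=\mathrm{Skel}_{i-1}(\Delta)$, $\widetilde H_i(\Upsilon)=0$, $\tilde\beta_{i-1}(\Upsilon)=\tilde\beta_{i-1}(\Delta)$ and $|\Upsilon_i|=|\Delta_i|-\tilde\beta_i(\mathrm{Skel}_i(\Delta))$; it is a *spanning $i$-tree* if moreover $\tilde\beta_{i-1}(\Delta)=0$. The complex $\Delta$ is a *tree* if it is a spanning $d$-tree of itself, and it is *acyclic in codimension one* if $\widetilde H_{d-1}(\Delta)=0$. For every integer $i$ with $1\le i\le d$ the following are equivalent: 1. every $\sigma\in X_{i-1}(\Delta)$ is winnable; 2. $K_{i-1}(\Delta)=0$; 3. $\mathrm{Skel}_i(\Delta)$ is a spanning $i$-tree of $\Delta$ and $\widetilde H_{i-1}(\Delta)=0$. In particular, when $i=d\ge1$, these three conditions are equivalent to $\Delta$ being a tree that is acyclic in codimension one. For $i=0\le d$, conditions (2) and (3) are still equivalent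 and they imply (1); if $d=0$, condition (2) with $i=0$ is equivalent to $\Delta$ being a tree that is acyclic in codimension one. -/

import Mathlib

/-! Finite simplicial complexes on the ordered vertex set `Fin n`.  Mathlib's
`PreAbstractSimplicialComplex` records the nonempty faces; the empty set is counted below as the
single face of dimension `-1`.  Vertices of `Fin n` need not all be faces. -/

namespace PreAbstractSimplicialComplex

variable {n : ℕ}

/-- The set `Δ_i` of `i`-dimensional faces: faces with `i + 1` elements. -/
abbrev Face (Δ : PreAbstractSimplicialComplex (Fin n)) (i : ℤ) : Type :=
  {s : Finset (Fin n) // (s = ∅ ∨ s ∈ Δ) ∧ (s.card : ℤ) = i + 1}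

noncomputable instance (Δ : PreAbstractSimplicialComplex (Fin n)) (i : ℤ) :
    Fintype (Δ.Face i) :=
  Fintype.ofFinite _

/-- The dimension: the largest dimension of a face (`-1` if only the empty face is present). -/
noncomputable def dim (Δ : PreAbstractSimplicialComplex (Fin n)) : ℤ :=
  open Classical in
  (((Finset.univ : Finset (Finset (Fin n))).filter (· ∈ Δ)).sup Finset.card : ℕ) - 1

/-- The `i`-skeleton: all faces of dimension at most `i`. -/
def skel (Δ : PreAbstractSimplicialComplex (Fin n)) (i : ℤ) :
    PreAbstractSimplicialComplex (Fin n) where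
  faces := {s | s ∈ Δ ∧ (s.card : ℤ) ≤ i + 1}
  isRelLowerSet_faces := by
    rintro s ⟨hs, hc⟩
    refine ⟨(Δ.isRelLowerSet_faces hs).1, fun t hts ht => ⟨?_, ?_⟩⟩
    · exact (Δ.isRelLowerSet_faces hs).2 hts ht
    · have := Finset.card_le_card hts
      omega

/-- Integral `i`-chains, the free abelian group on `Δ_i`, with the componentwise order. -/
abbrev Chain (Δ : PreAbstractSimplicialComplex (Fin n)) (i : ℤ) : Type :=
  Δ.Face i → ℤ

/-- The incidence matrix, for the standard orientation, of the boundary map from `a`-chains to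
`b`-chains: if `s = {v_0 < ⋯ < v_a}` and `t = s \ {v_j}` the entry is `(-1) ^ j`, otherwise `0`.
It is of interest for `b = a - 1`; the target dimension is an argument of its own so that
`a = i + 1`, `b = i` is allowed. -/
def boundaryMatrix (Δ : PreAbstractSimplicialComplex (Fin n)) (a b : ℤ) :
    Matrix (Δ.Face b) (Δ.Face a) ℤ :=
  Matrix.of fun t s =>
    ∑ v ∈ s.1, if t.1 = s.1.erase v then (-1) ^ (s.1.filter (· < v)).card else 0

/-- The boundary map `∂_a`, for `b = a - 1`. -/
noncomputable def boundary (Δ : PreAbstractSimplicialComplex (Fin n)) (a b : ℤ) :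
    Δ.Chain a →ₗ[ℤ] Δ.Chain b :=
  (Δ.boundaryMatrix a b).mulVecLin

/-- The transpose `∂_aᵗ` of the boundary map, for `b = a - 1`. -/
noncomputable def boundaryTranspose (Δ : PreAbstractSimplicialComplex (Fin n)) (a b : ℤ) :
    Δ.Chain b →ₗ[ℤ] Δ.Chain a :=
  (Δ.boundaryMatrix a b).transpose.mulVecLin

/-- The cycles `ker ∂_i`. -/
noncomputable abbrev cycles (Δ : PreAbstractSimplicialComplex (Fin n)) (i : ℤ) :
    Submodule ℤ (Δ.Chain i) :=
  LinearMap.ker (Δ.boundary i (i - 1))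

/-- Reduced homology `ker ∂_i / im ∂_{i+1}`. -/
abbrev ReducedHomology (Δ : PreAbstractSimplicialComplex (Fin n)) (i : ℤ) : Type :=
  Δ.cycles i ⧸ (LinearMap.range (Δ.boundary (i + 1) i)).submoduleOf (Δ.cycles i)

/-- The reduced Betti number, the rank of reduced homology. -/
noncomputable def betti (Δ : PreAbstractSimplicialComplex (Fin n)) (i : ℤ) : ℕ :=
  Module.finrank ℤ (Δ.ReducedHomology i)

/-- The Laplacian `L_i = ∂_{i+1} ∂_{i+1}ᵗ`. -/
noncomputable def laplacian (Δ : PreAbstractSimplicialComplex (Fin n)) (i : ℤ) :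
    Δ.Chain i →ₗ[ℤ] Δ.Chain i :=
  Δ.boundary (i + 1) i ∘ₗ Δ.boundaryTranspose (i + 1) i

/-- The critical group `K_i(Δ) = ker ∂_i / im L_i`. -/
abbrev CriticalGroup (Δ : PreAbstractSimplicialComplex (Fin n)) (i : ℤ) : Type :=
  Δ.cycles i ⧸ (LinearMap.range (Δ.laplacian i)).submoduleOf (Δ.cycles i)

/-- Linear equivalence of `i`-chains. -/
def LinearlyEquivalent (Δ : PreAbstractSimplicialComplex (Fin n)) {i : ℤ}
    (σ σ' : Δ.Chain i) : Prop :=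
  ∃ v : Δ.Chain i, σ' = σ + Δ.laplacian i v

/-- A chain is winnable if it is linearly equivalent to an effective chain. -/
def Winnable (Δ : PreAbstractSimplicialComplex (Fin n)) {i : ℤ} (σ : Δ.Chain i) : Prop :=
  ∃ σ' : Δ.Chain i, 0 ≤ σ' ∧ Δ.LinearlyEquivalent σ σ'

/-- `Λ_i(Δ)`: nonnegative integer combinations of the boundaries of the `(i+1)`-faces. -/
noncomputable def boundaryCone (Δ : PreAbstractSimplicialComplex (Fin n)) (i : ℤ) :
    AddSubmonoid (Δ.Chain i) :=
  open Classical in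
  AddSubmonoid.closure
    (Set.range fun f : Δ.Face (i + 1) => Δ.boundary (i + 1) i (Pi.single f 1))

/-- The Corry–Keenan set `X_i(Δ)` of `i`-chains whose boundary lies in `Λ_{i-1}(Δ)`. -/
def corryKeenan (Δ : PreAbstractSimplicialComplex (Fin n)) (i : ℤ) : Set (Δ.Chain i) :=
  {σ | Δ.boundary i (i - 1) σ ∈ Δ.boundaryCone (i - 1)}

/-- `Υ` is a spanning `i`-forest of `Δ`. -/
structure IsSpanningForest (Δ Υ : PreAbstractSimplicialComplex (Fin n)) (i : ℤ) : Prop where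
  le : Υ ≤ Δ
  dim_eq : Υ.dim = i
  skel_eq : Υ.skel (i - 1) = Δ.skel (i - 1)
  homology_eq_zero : Subsingleton (Υ.ReducedHomology i)
  betti_eq : Υ.betti (i - 1) = Δ.betti (i - 1)
  card_eq : (Fintype.card (Υ.Face i) : ℤ) = Fintype.card (Δ.Face i) - (Δ.skel i).betti i

/-- `Υ` is a spanning `i`-tree of `Δ`. -/
structure IsSpanningTree (Δ Υ : PreAbstractSimplicialComplex (Fin n)) (i : ℤ) : Prop
    extends IsSpanningForest Δ Υ i where
  betti_eq_zero : Δ.betti (i - 1) = 0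

/-- `Δ` is a tree: a spanning tree of itself in its own dimension. -/
def IsTree (Δ : PreAbstractSimplicialComplex (Fin n)) : Prop :=
  Δ.IsSpanningTree Δ Δ.dim

end PreAbstractSimplicialComplex

/-!
Write `M` for the matrix of `∂_i` and `N` for that of `∂_{i-1}`, so that `N M = 0` and the critical
group is `ker N / im M Mᵀ`.

*Trivial critical group and trees.* The critical group vanishes exactly when `M` is injective and
`ker N = im M` (`Matrix.ker_le_range_mul_transpose_iff`); for `Skel_i` these are the conditions of
being a spanning tree with vanishing codimension-one homology.  If `M` is injective onto `ker N`,
then, as `ker N` is a direct summand, `M` is split and `Mᵀ` is surjective, so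
`im M Mᵀ = im M = ker N`.  Conversely, if `ker N = im M Mᵀ`, every standard basis vector is an
orthogonal sum `a + b` of integer vectors with `a ∈ im Mᵀ` and `b ∈ ker M`.  Having norm one, it
equals `a` or `b`; it is not in `ker M` since a face of nonnegative dimension has nonzero boundary.
Hence all basis vectors lie in `im Mᵀ`, and `ker M`, which is orthogonal to them, vanishes.

*Trivial critical group and winnability.* If `∂σ = ∂c` with `c` effective and the critical group is
trivial, then `c - σ` is in the image of the Laplacian, so `σ` is winnable.  Conversely, every cycle
lies in the Corry–Keenan set.  If it is winnable, it is linearly equivalent to an effective cycle,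
and in dimension at least `0` this is zero (`eq_zero_of_nonneg_of_boundary_eq_zero`), whence the
cycle is in the image of the Laplacian.
-/

open Matrix

/-! ### Integer matrices -/

/-- Each standard basis vector is the sum of orthogonal integer vectors in `im Mᵀ` and `ker M`. It has
norm one, so one summand is zero, and by `hcol` this is the one in `ker M`. -/
theorem Matrix.mulVec_injective_of_range_le {m n : Type*} [Fintype m] [Fintype n] [DecidableEq n]
    (M : Matrix m n ℤ) (hcol : ∀ f, M *ᵥ Pi.single f 1 ≠ 0)
    (h : ∀ x, ∃ w, M *ᵥ x = M *ᵥ (Mᵀ *ᵥ w)) {z : n → ℤ} (hz : M *ᵥ z = 0) : z = 0 := by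
  funext f
  obtain ⟨w, hw⟩ := h (Pi.single f 1)
  set a := Mᵀ *ᵥ w with ha
  have adj (x : n → ℤ) : a ⬝ᵥ x = w ⬝ᵥ (M *ᵥ x) := by
    rw [ha, mulVec_transpose, dotProduct_mulVec]
  have horth : a ⬝ᵥ a = a f := by
    rw [adj, ← hw, ← adj]; simp
  have hsplit : a f * a f + ∑ g ∈ Finset.univ.erase f, a g * a g = a f := by
    rw [Finset.add_sum_erase _ (fun g => a g * a g) (Finset.mem_univ f)]; exact horth
  have hnn : ∀ g ∈ Finset.univ.erase f, 0 ≤ a g * a g := fun g _ => mul_self_nonneg _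
  have hrest := Finset.sum_nonneg hnn
  -- `∑ g, a g ^ 2 = a f` forces `a = 0` or `a = e_f`.
  have hf : a f = 0 ∨ a f = 1 := by
    have h0 : 0 ≤ a f := by nlinarith [mul_self_nonneg (a f)]
    have h1 : a f ≤ 1 := by nlinarith
    omega
  have hz0 : ∑ g ∈ Finset.univ.erase f, a g * a g = 0 := by
    rcases hf with hf | hf <;> rw [hf] at hsplit <;> linarith
  have hother : ∀ g, g ≠ f → a g = 0 := fun g hg =>
    mul_self_eq_zero.1 ((Finset.sum_eq_zero_iff_of_nonneg hnn).1 hz0 g (by simp [hg]))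
  have haf : a = Pi.single f (a f) := by
    funext g
    by_cases hg : g = f
    · subst hg; simp
    · simp [hg, hother g hg]
  rcases hf with hf | hf
  · rw [hf, Pi.single_zero] at haf
    exact absurd (by rw [hw, haf, mulVec_zero]) (hcol f)
  · have := adj z
    rw [hz, haf, hf] at this
    simpa using this

/-- A complementary projection onto the kernel of `N` turns an injection `M` onto that kernel into a
split one; transposing the left inverse gives a right inverse of `Mᵀ`. -/
theorem Matrix.transpose_mulVec_surjective {l m n : Type*} [Fintype l] [Fintype m] [Fintype n]
    (N : Matrix l m ℤ) (M : Matrix m n ℤ) (hNM : N * M = 0)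
    (hinj : ∀ z, M *ᵥ z = 0 → z = 0) (hex : ∀ x, N *ᵥ x = 0 → ∃ y, M *ᵥ y = x) (y : n → ℤ) :
    ∃ w, Mᵀ *ᵥ w = y := by
  classical
  let g := N.mulVecLin
  obtain ⟨s, hs⟩ := g.rangeRestrict.exists_rightInverse_of_surjective g.range_rangeRestrict
  let p : (m → ℤ) →ₗ[ℤ] (m → ℤ) := LinearMap.id - s ∘ₗ g.rangeRestrict
  have hp (x) : N *ᵥ p x = 0 := by
    have h1 : g.rangeRestrict (s (g.rangeRestrict x)) = g.rangeRestrict x :=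
      LinearMap.congr_fun hs _
    have h2 := congrArg Subtype.val h1
    change N *ᵥ (x - s (g.rangeRestrict x)) = 0
    rw [mulVec_sub, sub_eq_zero]
    exact h2.symm
  have hpM (x) : p (M *ᵥ x) = M *ᵥ x := by
    have : g.rangeRestrict (M *ᵥ x) = 0 := Subtype.ext (by
      change N *ᵥ (M *ᵥ x) = 0
      rw [mulVec_mulVec, hNM, zero_mulVec])
    change M *ᵥ x - s (g.rangeRestrict (M *ᵥ x)) = _
    rw [this, map_zero, sub_zero]
  -- The rows of the left inverse `R` are read off on the standard basis.
  choose q hq using fun e : m => hex _ (hp (Pi.single e 1))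
  let R : Matrix n m ℤ := Matrix.of fun i e => q e i
  have hMR (x) : M *ᵥ (R *ᵥ x) = p x := by
    suffices h : (M * R).mulVecLin = p by
      rw [mulVec_mulVec]; exact LinearMap.congr_fun h x
    refine LinearMap.pi_ext' fun e => LinearMap.ext_ring ?_
    simp only [LinearMap.comp_apply, LinearMap.single_apply, mulVecLin_apply, ← mulVec_mulVec]
    rw [← hq e, mulVec_single_one]
    rfl
  have hRM : R * M = 1 := by
    apply mulVec_injective
    funext x
    rw [one_mulVec, ← sub_eq_zero]
    apply hinj
    rw [mulVec_sub, ← mulVec_mulVec, hMR, hpM, sub_self]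
  refine ⟨Rᵀ *ᵥ y, ?_⟩
  rw [mulVec_mulVec, ← transpose_mul, hRM, transpose_one, one_mulVec]

/-- For a complex `M`, `N` of integer matrices in which `M` has no zero column, the kernel of `N`
is the image of `M Mᵀ` exactly when `M` is injective and the complex is exact in the middle. -/
theorem Matrix.ker_le_range_mul_transpose_iff {l m n : Type*} [Fintype l] [Fintype m] [Fintype n]
    [DecidableEq n] (N : Matrix l m ℤ) (M : Matrix m n ℤ) (hNM : N * M = 0)
    (hcol : ∀ f, M *ᵥ Pi.single f 1 ≠ 0) :
    (∀ x, N *ᵥ x = 0 → ∃ w, M *ᵥ (Mᵀ *ᵥ w) = x) ↔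
      (∀ z, M *ᵥ z = 0 → z = 0) ∧ ∀ x, N *ᵥ x = 0 → ∃ y, M *ᵥ y = x := by
  constructor
  · intro h
    refine ⟨fun z => M.mulVec_injective_of_range_le hcol fun x => ?_, fun x hx => ?_⟩
    · obtain ⟨w, hw⟩ := h (M *ᵥ x) (by rw [mulVec_mulVec, hNM, zero_mulVec])
      exact ⟨w, hw.symm⟩
    · obtain ⟨w, hw⟩ := h x hx
      exact ⟨_, hw⟩
  · rintro ⟨hinj, hex⟩ x hx
    obtain ⟨y, rfl⟩ := hex x hx
    obtain ⟨w, rfl⟩ := N.transpose_mulVec_surjective M hNM hinj hex y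
    exact ⟨w, rfl⟩

namespace PreAbstractSimplicialComplex

variable {n : ℕ} {Δ : PreAbstractSimplicialComplex (Fin n)}

/-! ### The simplicial boundary -/

/-- The `i`-face obtained from an `(i + 1)`-face by deleting a vertex. -/
def Face.erase {a b : ℤ} (s : Δ.Face a) (v : Fin n) (hv : v ∈ s.1) (hab : a = b + 1) : Δ.Face b :=
  ⟨s.1.erase v, by
    rcases (s.1.erase v).eq_empty_or_nonempty with h | h
    · exact Or.inl h
    · refine Or.inr (s.2.1.elim (fun h0 => ?_) fun hs => ?_)
      · simp [h0] at hv
      · exact (Δ.isRelLowerSet_faces hs).2 (Finset.erase_subset _ _) h, by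
    have h1 := s.2.2
    have h2 := Finset.card_erase_add_one hv
    omega⟩

theorem Face.nonempty {a : ℤ} (s : Δ.Face a) (ha : 0 ≤ a) : s.1.Nonempty := by
  have := s.2.2
  exact Finset.card_pos.1 (by omega)

theorem boundaryMatrix_erase {a b : ℤ} (s : Δ.Face a) (t : Δ.Face b) {v : Fin n} (hv : v ∈ s.1)
    (ht : t.1 = s.1.erase v) :
    Δ.boundaryMatrix a b t s = (-1) ^ (s.1.filter (· < v)).card := by
  rw [boundaryMatrix, of_apply, Finset.sum_eq_single_of_mem v hv, if_pos ht]
  intro w hw hwv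
  rw [if_neg]
  intro h
  exact hwv ((Finset.erase_injOn s.1) hw hv (h.symm.trans ht))

theorem boundaryMatrix_eq_zero {a b : ℤ} (s : Δ.Face a) (t : Δ.Face b)
    (h : ∀ v ∈ s.1, t.1 ≠ s.1.erase v) : Δ.boundaryMatrix a b t s = 0 :=
  Finset.sum_eq_zero fun v hv => if_neg (h v hv)

theorem sign_erase_of_lt (s : Finset (Fin n)) {v w : Fin n} (hv : v ∈ s) (hvw : v < w) :
    (-1 : ℤ) ^ ((s.erase v).filter (· < w)).card * (-1) ^ (s.filter (· < v)).card =
      -((-1) ^ ((s.erase w).filter (· < v)).card * (-1) ^ (s.filter (· < w)).card) := by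
  have h1 : ((s.erase v).filter (· < w)).card + 1 = (s.filter (· < w)).card := by
    rw [Finset.filter_erase]
    exact Finset.card_erase_add_one (by simp [hv, hvw])
  have h2 : (s.erase w).filter (· < v) = s.filter (· < v) := by
    rw [Finset.filter_erase]
    exact Finset.erase_eq_of_notMem (by simp [hvw.le])
  rw [h2, ← h1, pow_succ]
  ring

/-- Deleting two vertices in either order gives opposite signs. -/
theorem sign_erase_swap (s : Finset (Fin n)) {v w : Fin n} (hv : v ∈ s) (hw : w ∈ s) (hvw : v ≠ w) :
    (-1 : ℤ) ^ ((s.erase v).filter (· < w)).card * (-1) ^ (s.filter (· < v)).card =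
      -((-1) ^ ((s.erase w).filter (· < v)).card * (-1) ^ (s.filter (· < w)).card) := by
  rcases hvw.lt_or_gt with h | h
  · exact sign_erase_of_lt s hv h
  · rw [sign_erase_of_lt s hw h, neg_neg]

theorem boundaryMatrix_mul_boundaryMatrix {a b c : ℤ} (hab : a = b + 1) :
    Δ.boundaryMatrix b c * Δ.boundaryMatrix a b = 0 := by
  ext u s
  let F (v w : Fin n) : ℤ := if u.1 = (s.1.erase v).erase w then
    (-1) ^ ((s.1.erase v).filter (· < w)).card * (-1) ^ (s.1.filter (· < v)).card else 0
  have hF : (Δ.boundaryMatrix b c * Δ.boundaryMatrix a b) u s =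
      ∑ v ∈ s.1, ∑ w ∈ s.1.erase v, F v w := by
    simp only [mul_apply, boundaryMatrix, of_apply, Finset.mul_sum]
    rw [Finset.sum_comm]
    refine Finset.sum_congr rfl fun v hv => ?_
    rw [Finset.sum_eq_single (s.erase v hv hab)]
    · have hsv : (s.erase v hv hab).1 = s.1.erase v := rfl
      rw [if_pos hsv, Finset.sum_mul, hsv]
      refine Finset.sum_congr rfl fun w _ => ?_
      simp only [F, ite_mul, zero_mul]
    · intro t _ ht
      have hts : t.1 ≠ s.1.erase v := fun h => ht (Subtype.ext h)
      rw [if_neg hts, mul_zero]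
    · simp
  have hswap : ∑ v ∈ s.1, ∑ w ∈ s.1.erase v, F v w = -∑ v ∈ s.1, ∑ w ∈ s.1.erase v, F v w := by
    conv_lhs => rw [Finset.sum_comm' (t' := s.1) (s' := fun w => s.1.erase w) (by
      intro v w; simp only [Finset.mem_erase]; tauto)]
    simp only [← Finset.sum_neg_distrib]
    refine Finset.sum_congr rfl fun v hv => Finset.sum_congr rfl fun w hw => ?_
    rw [Finset.mem_erase] at hw
    simp only [F, Finset.erase_right_comm (a := w) (b := v)]
    split_ifs
    · exact sign_erase_swap s.1 hw.2 hv hw.1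
    · simp
  rw [hF, Matrix.zero_apply]
  omega

theorem boundary_boundary {a b c : ℤ} (hab : a = b + 1) (x : Δ.Chain a) :
    Δ.boundary b c (Δ.boundary a b x) = 0 := by
  simp only [boundary, mulVecLin_apply, mulVec_mulVec, boundaryMatrix_mul_boundaryMatrix hab,
    zero_mulVec]

theorem boundaryMatrix_mulVec_single_ne_zero {a b : ℤ} [DecidableEq (Δ.Face a)] (hab : a = b + 1)
    (ha : 0 ≤ a) (s : Δ.Face a) : Δ.boundaryMatrix a b *ᵥ Pi.single s 1 ≠ 0 := by
  obtain ⟨v, hv⟩ := s.nonempty ha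
  intro h
  have h1 := congrFun h (s.erase v hv hab)
  rw [mulVec_single_one, col_apply, boundaryMatrix_erase s _ hv rfl] at h1
  simp at h1

/-- Among the facets opposite to the least vertex of a face in the support, choose one with the
largest vertex sum. A face containing it by another vertex than its least would yield a larger
one, so no negative incidence can cancel the positive one. -/
theorem eq_zero_of_nonneg_of_boundary_eq_zero {a b : ℤ} (hab : a = b + 1) (ha : 0 ≤ a)
    {σ : Δ.Chain a} (hσ : 0 ≤ σ) (hcyc : Δ.boundary a b σ = 0) : σ = 0 := by
  classical
  by_contra hne
  obtain ⟨s₀, hs₀⟩ := Function.ne_iff.1 hne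
  let wt (s : Δ.Face a) : ℕ := ∑ v ∈ s.1.erase (s.1.min' (s.nonempty ha)), (v : ℕ)
  obtain ⟨s, hs, hmax⟩ := Finset.exists_max_image (Finset.univ.filter (σ · ≠ 0)) wt
    ⟨s₀, by simpa using hs₀⟩
  simp only [Finset.mem_filter, Finset.mem_univ, true_and] at hs hmax
  let t : Δ.Face b := s.erase _ (s.1.min'_mem (s.nonempty ha)) hab
  have hmin : Δ.boundaryMatrix a b t s = 1 := by
    rw [boundaryMatrix_erase s t (s.1.min'_mem (s.nonempty ha)) rfl]
    rw [Finset.filter_false_of_mem (fun x hx => not_lt.2 (s.1.min'_le x hx))]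
    simp
  have hnn : ∀ r ∈ Finset.univ, 0 ≤ Δ.boundaryMatrix a b t r * σ r := by
    intro r _
    by_cases hr : σ r = 0
    · simp [hr]
    refine mul_nonneg ?_ (hσ r)
    by_cases h : ∃ v ∈ r.1, t.1 = r.1.erase v
    · obtain ⟨v, hv, htv⟩ := h
      have hle := hmax r hr
      have hmr := r.1.min'_mem (r.nonempty ha)
      have h1 := Finset.sum_erase_add r.1 (fun v : Fin n => (v : ℕ)) hmr
      have h2 := Finset.sum_erase_add r.1 (fun v : Fin n => (v : ℕ)) hv
      have h3 : wt s = ∑ v ∈ r.1.erase v, (v : ℕ) := by rw [← htv]; rfl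
      have hv' : v = r.1.min' (r.nonempty ha) := by
        refine le_antisymm (Fin.le_def.2 ?_) (r.1.min'_le v hv)
        simp only [wt] at hle h3
        omega
      rw [boundaryMatrix_erase r t hv htv,
        Finset.filter_false_of_mem (fun x hx => not_lt.2 (hv' ▸ r.1.min'_le x hx))]
      simp
    · rw [boundaryMatrix_eq_zero r t (by simpa using h)]
  have hsum : ∑ r, Δ.boundaryMatrix a b t r * σ r = 0 := congrFun hcyc t
  have := (Finset.sum_eq_zero_iff_of_nonneg hnn).1 hsum s (Finset.mem_univ s)
  rw [hmin, one_mul] at this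
  exact hs this

/-! ### Homology, critical groups and winnable chains -/

theorem mem_cycles_iff {a b : ℤ} (hab : a = b + 1) (x : Δ.Chain a) :
    x ∈ Δ.cycles a ↔ Δ.boundary a b x = 0 := by
  obtain rfl : b = a - 1 := by omega
  exact LinearMap.mem_ker

theorem subsingleton_reducedHomology_iff {a b : ℤ} (hab : a = b + 1) :
    Subsingleton (Δ.ReducedHomology a) ↔
      ∀ x, Δ.boundary a b x = 0 → ∃ y, Δ.boundary (a + 1) a y = x := by
  rw [Submodule.Quotient.subsingleton_iff, Submodule.submoduleOf_eq_top]
  simp only [← mem_cycles_iff hab]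
  rfl

theorem subsingleton_criticalGroup_iff {a b : ℤ} (hab : a = b + 1) :
    Subsingleton (Δ.CriticalGroup a) ↔ ∀ x, Δ.boundary a b x = 0 → ∃ y, Δ.laplacian a y = x := by
  rw [Submodule.Quotient.subsingleton_iff, Submodule.submoduleOf_eq_top]
  simp only [← mem_cycles_iff hab]
  rfl

theorem subsingleton_criticalGroup_iff_injective_and_exact {a b : ℤ} (hab : a = b + 1)
    (ha : 0 ≤ a + 1) :
    Subsingleton (Δ.CriticalGroup a) ↔
      (∀ z, Δ.boundary (a + 1) a z = 0 → z = 0) ∧ Subsingleton (Δ.ReducedHomology a) := by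
  rw [subsingleton_criticalGroup_iff hab, subsingleton_reducedHomology_iff hab]
  exact (Δ.boundaryMatrix a b).ker_le_range_mul_transpose_iff (Δ.boundaryMatrix (a + 1) a)
    (boundaryMatrix_mul_boundaryMatrix rfl) (boundaryMatrix_mulVec_single_ne_zero rfl ha)

theorem boundary_laplacian {a b : ℤ} (v : Δ.Chain a) :
    Δ.boundary a b (Δ.laplacian a v) = 0 :=
  boundary_boundary rfl _

/-- Elements of the cone are the boundaries of effective chains. -/
theorem exists_nonneg_of_mem_boundaryCone {i : ℤ} {τ : Δ.Chain i} (hτ : τ ∈ Δ.boundaryCone i) :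
    ∃ c : Δ.Chain (i + 1), 0 ≤ c ∧ Δ.boundary (i + 1) i c = τ := by
  classical
  induction hτ using AddSubmonoid.closure_induction with
  | mem x hx =>
    obtain ⟨f, rfl⟩ := hx
    exact ⟨_, Pi.single_nonneg.2 zero_le_one, rfl⟩
  | zero => exact ⟨0, le_rfl, map_zero _⟩
  | add x y _ _ hx hy =>
    obtain ⟨c, hc, rfl⟩ := hx
    obtain ⟨c', hc', rfl⟩ := hy
    exact ⟨c + c', add_nonneg hc hc', map_add _ _ _⟩

theorem winnable_of_subsingleton_criticalGroup {a : ℤ} (h : Subsingleton (Δ.CriticalGroup a)) :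
    ∀ σ ∈ Δ.corryKeenan a, Δ.Winnable σ := by
  intro σ hσ
  obtain ⟨b, rfl⟩ : ∃ b, a = b + 1 := ⟨a - 1, by omega⟩
  rw [subsingleton_criticalGroup_iff rfl] at h
  have hσ' : Δ.boundary (b + 1) b σ ∈ Δ.boundaryCone b := by
    have e : b + 1 - 1 = b := by omega
    simp only [corryKeenan, Set.mem_ofPred_eq] at hσ
    rwa [e] at hσ
  obtain ⟨c, hc, hcσ⟩ := exists_nonneg_of_mem_boundaryCone hσ'
  obtain ⟨v, hv⟩ := h (c - σ) (by rw [map_sub, hcσ, sub_self])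
  exact ⟨c, hc, v, by rw [hv, add_sub_cancel]⟩

theorem subsingleton_criticalGroup_of_winnable {a : ℤ} (ha : 0 ≤ a)
    (h : ∀ σ ∈ Δ.corryKeenan a, Δ.Winnable σ) : Subsingleton (Δ.CriticalGroup a) := by
  rw [subsingleton_criticalGroup_iff (b := a - 1) (by omega)]
  intro x hx
  have hmem : x ∈ Δ.corryKeenan a := by
    simp only [corryKeenan, Set.mem_ofPred_eq, hx]
    exact zero_mem _
  obtain ⟨τ, hτ, v, rfl⟩ := h x hmem
  have h0 := eq_zero_of_nonneg_of_boundary_eq_zero (b := a - 1) (by omega) ha hτ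
    (by rw [map_add, hx, boundary_laplacian, add_zero])
  exact ⟨-v, by rw [map_neg, eq_comm]; exact eq_neg_of_add_eq_zero_left h0⟩

/-! ### Skeleta -/

theorem mem_skel {i : ℤ} {s : Finset (Fin n)} :
    s ∈ Δ.skel i ↔ s ∈ Δ ∧ (s.card : ℤ) ≤ i + 1 :=
  Iff.rfl

theorem skel_le (i : ℤ) : Δ.skel i ≤ Δ :=
  fun _ hs => hs.1

theorem card_le_dim_add_one {s : Finset (Fin n)} (hs : s ∈ Δ) : (s.card : ℤ) ≤ Δ.dim + 1 := by
  classical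
  have : s.card ≤ (((Finset.univ : Finset (Finset (Fin n))).filter (· ∈ Δ)).sup Finset.card) :=
    Finset.le_sup (f := Finset.card) (by simpa using hs)
  unfold dim
  convert Int.ofNat_le.2 this using 1
  ring_nf

theorem exists_card_eq_dim_add_one (h : 0 ≤ Δ.dim) : ∃ s ∈ Δ, (s.card : ℤ) = Δ.dim + 1 := by
  classical
  have hne : ((Finset.univ : Finset (Finset (Fin n))).filter (· ∈ Δ)).Nonempty := by
    by_contra hempty
    rw [Finset.not_nonempty_iff_eq_empty] at hempty
    have : Δ.dim = -1 := by
      unfold dim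
      convert_to ((((Finset.univ : Finset (Finset (Fin n))).filter (· ∈ Δ)).sup Finset.card : ℕ)
        : ℤ) - 1 = -1
      rw [hempty]; simp
    omega
  obtain ⟨s, hs, hcard⟩ := Finset.exists_mem_eq_sup _ hne Finset.card
  refine ⟨s, by simpa using hs, ?_⟩
  rw [← hcard]
  unfold dim
  rw [sub_add_cancel]

theorem skel_dim : Δ.skel Δ.dim = Δ :=
  le_antisymm (skel_le _) fun _ hs => ⟨hs, card_le_dim_add_one hs⟩

theorem dim_skel {i : ℤ} (hi : 0 ≤ i) (hid : i ≤ Δ.dim) : (Δ.skel i).dim = i := by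
  obtain ⟨s, hs, hcard⟩ := exists_card_eq_dim_add_one (hi.trans hid)
  obtain ⟨t, hts, ht⟩ := Finset.exists_subset_card_eq (s := s) (n := (i + 1).toNat) (by omega)
  have htΔ : t ∈ Δ := (Δ.isRelLowerSet_faces hs).2 hts (Finset.card_pos.1 (by omega))
  have hge := card_le_dim_add_one (Δ := Δ.skel i) (mem_skel.2 ⟨htΔ, by omega⟩)
  obtain ⟨u, hu, hucard⟩ := exists_card_eq_dim_add_one (Δ := Δ.skel i) (by omega)
  have := (mem_skel.1 hu).2
  omega

theorem skel_skel {i j : ℤ} (hij : j ≤ i) : (Δ.skel i).skel j = Δ.skel j :=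
  le_antisymm (fun _ hs => ⟨hs.1.1, hs.2⟩) fun s hs =>
    ⟨⟨hs.1, (mem_skel.1 hs).2.trans (by omega)⟩, hs.2⟩

/-- The faces of dimension `a ≤ i` are those of the `i`-skeleton. -/
def faceSkelEquiv (Δ : PreAbstractSimplicialComplex (Fin n)) {i a : ℤ} (ha : a ≤ i) :
    (Δ.skel i).Face a ≃ Δ.Face a :=
  Equiv.subtypeEquivRight fun s => by
    rw [mem_skel]
    constructor
    · rintro ⟨h, hc⟩
      exact ⟨h.imp_right And.left, hc⟩
    · rintro ⟨h, hc⟩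
      exact ⟨h.imp_right fun h => ⟨h, by omega⟩, hc⟩

theorem boundary_skel {i a b : ℤ} (ha : a ≤ i) (hb : b ≤ i) (x : Δ.Chain a) :
    (Δ.skel i).boundary a b (x ∘ Δ.faceSkelEquiv ha) =
      Δ.boundary a b x ∘ Δ.faceSkelEquiv hb := by
  funext t
  exact (Δ.faceSkelEquiv ha).sum_comp
    fun s => Δ.boundaryMatrix a b (Δ.faceSkelEquiv hb t) s * x s

theorem boundary_skel_eq_zero_iff {i a b : ℤ} (ha : a ≤ i) (hb : b ≤ i) (x : Δ.Chain a) :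
    (Δ.skel i).boundary a b (x ∘ Δ.faceSkelEquiv ha) = 0 ↔ Δ.boundary a b x = 0 := by
  rw [boundary_skel ha hb]
  constructor
  · intro h
    funext t
    simpa using congrFun h ((Δ.faceSkelEquiv hb).symm t)
  · intro h
    rw [h]
    rfl

theorem exists_comp_faceSkelEquiv {i a : ℤ} (ha : a ≤ i) (y : (Δ.skel i).Chain a) :
    ∃ x : Δ.Chain a, x ∘ Δ.faceSkelEquiv ha = y :=
  ⟨y ∘ (Δ.faceSkelEquiv ha).symm, by funext t; simp⟩

theorem subsingleton_reducedHomology_skel {i a : ℤ} (ha : a + 1 ≤ i)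
    (h : Subsingleton (Δ.ReducedHomology a)) : Subsingleton ((Δ.skel i).ReducedHomology a) := by
  have hab : a = a - 1 + 1 := by omega
  rw [subsingleton_reducedHomology_iff hab] at h ⊢
  intro y hy
  obtain ⟨x, rfl⟩ := exists_comp_faceSkelEquiv (by omega) y
  rw [boundary_skel_eq_zero_iff _ (by omega)] at hy
  obtain ⟨z, rfl⟩ := h x hy
  exact ⟨_, boundary_skel ha (by omega) z⟩

/-- The `i`-skeleton has no `(i + 1)`-faces, so its top homology consists of all cycles. -/
theorem subsingleton_reducedHomology_skel_self_iff {i b : ℤ} (hib : i = b + 1) (hi : -1 ≤ i) :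
    Subsingleton ((Δ.skel i).ReducedHomology i) ↔ ∀ z, Δ.boundary i b z = 0 → z = 0 := by
  have hempty : IsEmpty ((Δ.skel i).Face (i + 1)) := ⟨fun s => by
    rcases s.2 with ⟨hs | hs, hc⟩
    · rw [hs, Finset.card_empty] at hc; omega
    · have := (mem_skel.1 hs).2; omega⟩
  rw [subsingleton_reducedHomology_iff hib]
  constructor
  · intro h z hz
    obtain ⟨y, hy⟩ := h _ ((boundary_skel_eq_zero_iff le_rfl (by omega) z).2 hz)
    rw [Subsingleton.elim y 0, map_zero] at hy
    funext t
    simpa using (congrFun hy ((Δ.faceSkelEquiv le_rfl).symm t)).symm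
  · intro h y hy
    obtain ⟨x, rfl⟩ := exists_comp_faceSkelEquiv le_rfl y
    rw [boundary_skel_eq_zero_iff _ (by omega)] at hy
    rw [h x hy]
    exact ⟨0, map_zero _⟩

/-! ### Spanning trees -/

theorem betti_eq_zero_of_subsingleton {i : ℤ} (h : Subsingleton (Δ.ReducedHomology i)) :
    Δ.betti i = 0 :=
  Module.finrank_zero_of_subsingleton

/-- With vanishing codimension-one homology, both Betti-number conditions on the skeleton are
automatic and the face count follows from the vanishing of the top homology. -/
theorem isSpanningTree_skel_iff {a : ℤ} (ha : 0 ≤ a + 1) (had : a + 1 ≤ Δ.dim)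
    (hH : Subsingleton (Δ.ReducedHomology a)) :
    Δ.IsSpanningTree (Δ.skel (a + 1)) (a + 1) ↔ ∀ z, Δ.boundary (a + 1) a z = 0 → z = 0 := by
  rw [← subsingleton_reducedHomology_skel_self_iff rfl (by omega)]
  refine ⟨fun h => h.homology_eq_zero, fun h => ?_⟩
  have e : a + 1 - 1 = a := by omega
  refine ⟨⟨skel_le _, dim_skel ha had, skel_skel (by omega), h, ?_, ?_⟩, ?_⟩
  · rw [e, betti_eq_zero_of_subsingleton hH,
      betti_eq_zero_of_subsingleton (subsingleton_reducedHomology_skel le_rfl hH)]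
  · rw [betti_eq_zero_of_subsingleton h, Nat.cast_zero, sub_zero,
      Fintype.card_congr (Δ.faceSkelEquiv le_rfl)]
  · rw [e, betti_eq_zero_of_subsingleton hH]

theorem subsingleton_criticalGroup_iff_isSpanningTree_skel {i : ℤ} (hi : 0 ≤ i)
    (hid : i ≤ Δ.dim) :
    Subsingleton (Δ.CriticalGroup (i - 1)) ↔
      Δ.IsSpanningTree (Δ.skel i) i ∧ Subsingleton (Δ.ReducedHomology (i - 1)) := by
  obtain ⟨a, rfl⟩ : ∃ a, i = a + 1 := ⟨i - 1, by omega⟩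
  rw [add_sub_cancel_right,
    subsingleton_criticalGroup_iff_injective_and_exact (b := a - 1) (by omega) hi]
  exact and_congr_left fun hH => (isSpanningTree_skel_iff hi hid hH).symm

end PreAbstractSimplicialComplex

/-- The equivalence for `1 ≤ i ≤ d`, its special case `i = d`, and what remains true for `i = 0`. -/
theorem mainTheorem7 (n : ℕ) (Δ : PreAbstractSimplicialComplex (Fin n)) :
    (∀ i : ℤ, 1 ≤ i → i ≤ Δ.dim →
      List.TFAE [
        ∀ σ ∈ Δ.corryKeenan (i - 1), Δ.Winnable σ,
        Subsingleton (Δ.CriticalGroup (i - 1)),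
        Δ.IsSpanningTree (Δ.skel i) i ∧ Subsingleton (Δ.ReducedHomology (i - 1))]) ∧
    (1 ≤ Δ.dim →
      List.TFAE [
        ∀ σ ∈ Δ.corryKeenan (Δ.dim - 1), Δ.Winnable σ,
        Subsingleton (Δ.CriticalGroup (Δ.dim - 1)),
        Δ.IsSpanningTree (Δ.skel Δ.dim) Δ.dim ∧ Subsingleton (Δ.ReducedHomology (Δ.dim - 1)),
        Δ.IsTree ∧ Subsingleton (Δ.ReducedHomology (Δ.dim - 1))]) ∧
    (0 ≤ Δ.dim →
      (Subsingleton (Δ.CriticalGroup (0 - 1)) ↔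
        Δ.IsSpanningTree (Δ.skel 0) 0 ∧ Subsingleton (Δ.ReducedHomology (0 - 1))) ∧
      (Subsingleton (Δ.CriticalGroup (0 - 1)) → ∀ σ ∈ Δ.corryKeenan (0 - 1), Δ.Winnable σ)) ∧
    (Δ.dim = 0 →
      (Subsingleton (Δ.CriticalGroup (Δ.dim - 1)) ↔
        Δ.IsTree ∧ Subsingleton (Δ.ReducedHomology (Δ.dim - 1)))) := by
  open PreAbstractSimplicialComplex in
  have h12 (i : ℤ) (hi : 1 ≤ i) : (∀ σ ∈ Δ.corryKeenan (i - 1), Δ.Winnable σ) ↔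
      Subsingleton (Δ.CriticalGroup (i - 1)) :=
    ⟨subsingleton_criticalGroup_of_winnable (by omega), winnable_of_subsingleton_criticalGroup⟩
  have h34 : Δ.IsTree ↔ Δ.IsSpanningTree (Δ.skel Δ.dim) Δ.dim := by rw [skel_dim]; rfl
  refine ⟨fun i hi hid => ?_, fun hd => ?_, fun hd => ⟨?_, ?_⟩, fun hd => ?_⟩
  · tfae_have 1 ↔ 2 := h12 i hi
    tfae_have 2 ↔ 3 := subsingleton_criticalGroup_iff_isSpanningTree_skel (by omega) hid
    tfae_finish
  · tfae_have 1 ↔ 2 := h12 _ hd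
    tfae_have 2 ↔ 3 := subsingleton_criticalGroup_iff_isSpanningTree_skel (by omega) le_rfl
    tfae_have 3 ↔ 4 := by rw [h34]
    tfae_finish
  · exact subsingleton_criticalGroup_iff_isSpanningTree_skel le_rfl hd
  · exact winnable_of_subsingleton_criticalGroup
  · rw [h34]
    exact subsingleton_criticalGroup_iff_isSpanningTree_skel hd.ge le_rfl
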